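/- Let $d\ge 1$ and let $\nu$ be a probability measure on $\mathbb R$ that is absolutely continuous with a bounded, compactly supported density $\rho$ (i.e. $\nu(B)=\int_B\rho(v)\,dv$ for Borel $B\subset\mathbb R$, with $\rho\in L^\infty(\mathbb R)$ of compact support). Let $\omega=(\omega_n)_{n\in\mathbb Z^d}$ be independent real random variables with common distribution $\nu$. For $\lambda>0$ let $$(h_{\omega,\lambda}u)(n)=-\sum_{k\in\mathbb Z^d,\,|k|=1}u(n+k)+\lambda\,\omega_n u(n),\qquad n\in\mathbb Z^d,$$ be the Anderson Hamiltonian, a self-adjoint operator on $\ell^2(\mathbb Z^d)$ with domain $\{u:\sum_n|\omega_nu(n)|^2<\infty\}$, where $|k|=|k_1|+\dots+|k_d|$. For $x,y\in\mathbb Z^d$ and $z\in\mathbb C\setminus\mathbb R$ let $$G_{\omega,\lambda}(x,y;z)=\langle e_x,(h_{\omega,\lambda}-z)^{-1}e_y\rangle$$ be its Green function, where $(e_x)_{x\in\mathbb Z^d}$ is the canonical basis of $\ell^2(\mathbb Z^d)$. Let $0<s<1$. Then there exists $\lambda_0>0$, depending only on $d$, $\rho$ and $s$, such that for every $\lambda\ge\lambda_0$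 there are constants $C<\infty$ and $\mu>0$, depending only on $d$, $\rho$, $s$ and $\lambda$, with $$\mathbb E\left(|G_{\omega,\lambda}(x,y;z)|^s\right)\le C e^{-\mu|x-y|}$$ for all $x,y\in\mathbb Z^d$ and all $z\in\mathbb C\setminus\mathbb R$. -/

import Mathlib

open MeasureTheory ProbabilityTheory
open scoped ENNReal

namespace Anderson

/-- The Hilbert space `ℓ²(ℤ^d)` of square-summable functions `ℤ^d → ℂ`. -/
abbrev Ell2 (d : ℕ) : Type := lp (fun _ : Fin d → ℤ => ℂ) 2

noncomputable section

/-- The graph distance `|n| = |n₁| + ... + |n_d|` of `n ∈ ℤ^d` from the origin. -/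
def latticeNorm {d : ℕ} (n : Fin d → ℤ) : ℤ := ∑ i, |n i|

/-- The finite set of all `k ∈ ℤ^d` with `|k| = 1`
(see `mem_unitVectors`; all entries of such a `k` lie in `{-1, 0, 1}`). -/
def unitVectors (d : ℕ) : Finset (Fin d → ℤ) :=
  (Fintype.piFinset fun _ => Finset.Icc (-1 : ℤ) 1).filter fun k => latticeNorm k = 1

theorem mem_unitVectors {d : ℕ} (k : Fin d → ℤ) :
    k ∈ unitVectors d ↔ latticeNorm k = 1 := by
  simp only [unitVectors, Finset.mem_filter, Fintype.mem_piFinset, Finset.mem_Icc,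
    and_iff_right_iff_imp]
  intro h i
  have h1 : |k i| ≤ ∑ j, |k j| :=
    Finset.single_le_sum (f := fun j => |k j|) (fun j _ => abs_nonneg _) (Finset.mem_univ i)
  have h2 : |k i| ≤ 1 := h1.trans h.le
  exact abs_le.mp h2

theorem memℓp_shift {d : ℕ} (u : Ell2 d) (k : Fin d → ℤ) :
    Memℓp (fun n : Fin d → ℤ => (u (n + k) : ℂ)) 2 := by
  have h := (memℓp_gen_iff (p := 2) (by norm_num)).1 (lp.memℓp u)
  refine (memℓp_gen_iff (p := 2) (by norm_num)).2 ?_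
  exact (Equiv.addRight k).summable_iff.2 h

theorem memℓp_laplacian {d : ℕ} (u : Ell2 d) :
    Memℓp (fun n : Fin d → ℤ => (-∑ k ∈ unitVectors d, u (n + k) : ℂ)) 2 := by
  have h : Memℓp (fun n : Fin d → ℤ => (∑ k ∈ unitVectors d, u (n + k) : ℂ)) 2 :=
    Memℓp.finsetSum (unitVectors d) (f := fun k n => (u (n + k) : ℂ))
      fun k _ => memℓp_shift u k
  exact h.neg

/-- The discrete Laplacian `(h₀ u)(n) = -∑_{|k| = 1} u(n + k)` on `ℓ²(ℤ^d)`. -/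
def laplacian (d : ℕ) : Ell2 d →ₗ[ℂ] Ell2 d where
  toFun u := ⟨fun n => -∑ k ∈ unitVectors d, u (n + k), memℓp_laplacian u⟩
  map_add' u v := by
    ext n
    change -∑ k ∈ unitVectors d, (u (n + k) + v (n + k)) =
      -∑ k ∈ unitVectors d, u (n + k) + -∑ k ∈ unitVectors d, v (n + k)
    rw [Finset.sum_add_distrib, neg_add]
  map_smul' c u := by
    ext n
    simp [Finset.mul_sum]

/-- The domain `{u ∈ ℓ²(ℤ^d) : ∑ |v(n) u(n)|² < ∞}` of the maximal operator of
multiplication by the potential `v : ℤ^d → ℝ`. -/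
def potentialDomain {d : ℕ} (v : (Fin d → ℤ) → ℝ) : Submodule ℂ (Ell2 d) where
  carrier := {u | Memℓp (fun n => (v n : ℂ) * u n) 2}
  zero_mem' := by
    have h : Memℓp (fun _ : Fin d → ℤ => (0 : ℂ)) 2 := zero_memℓp
    simpa using h
  add_mem' {a b} ha hb := by
    have h := Memℓp.add ha hb
    simpa [mul_add, Pi.add_def] using h
  smul_mem' c a ha := by
    have h := Memℓp.const_smul ha c
    simpa [Pi.smul_def, mul_left_comm] using h

/-- The maximal operator of multiplication by the potential `v`. -/
def potential {d : ℕ} (v : (Fin d → ℤ) → ℝ) : Ell2 d →ₗ.[ℂ] Ell2 d where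
  domain := potentialDomain v
  toFun :=
    { toFun := fun u => ⟨fun n => (v n : ℂ) * u.1 n, u.2⟩
      map_add' := fun a b => by
        ext n
        exact mul_add (v n : ℂ) (a.1 n) (b.1 n)
      map_smul' := fun c a => by
        ext n
        simp [mul_left_comm] }

/-- The Schrödinger operator `h₀ + v`, with domain the domain of multiplication by `v`
(all of `ℓ²(ℤ^d)` if `v` is bounded). -/
def schrodinger {d : ℕ} (v : (Fin d → ℤ) → ℝ) : Ell2 d →ₗ.[ℂ] Ell2 d :=
  laplacian d +ᵥ potential v

/-- The Anderson Hamiltonian `h_{ω,lam} = h₀ + lam V_ω` with `V_ω(n) = ω_n`, at disorder `lam`. -/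
def hamiltonian {d : ℕ} (lam : ℝ) (ω : (Fin d → ℤ) → ℝ) : Ell2 d →ₗ.[ℂ] Ell2 d :=
  schrodinger fun n => lam * ω n

open Classical in
/-- `(T - z)⁻¹ f`: the vector `u` in the domain of `T` with `T u - z u = f`.
It exists and is unique if `T` is self-adjoint and `z` is not real. -/
def resolventApply {d : ℕ} (T : Ell2 d →ₗ.[ℂ] Ell2 d) (z : ℂ) (f : Ell2 d) :
    Ell2 d :=
  if h : ∃ u : T.domain, T u - z • (u : Ell2 d) = f then (h.choose : Ell2 d) else 0

/-- The canonical basis vector `e_x` of `ℓ²(ℤ^d)`. -/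
def basisVec {d : ℕ} (x : Fin d → ℤ) : Ell2 d := lp.single 2 x (1 : ℂ)

/-- The Green function `G_{ω,lam}(x, y; z) = ⟨e_x, (h_{ω,lam} - z)⁻¹ e_y⟩`
(the inner product is linear in the second argument). -/
def green {d : ℕ} (lam : ℝ) (ω : (Fin d → ℤ) → ℝ) (x y : Fin d → ℤ) (z : ℂ) : ℂ :=
  inner ℂ (basisVec x) (resolventApply (hamiltonian lam ω) z (basisVec y))

end

end Anderson

/-!
The resolvent equation at the site `x` reads `(V x - z) G(x, y) = δ_{xy} + ∑_k G(x + k, y)`. As a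
function of the single value `V x`, the rank-one perturbation (Krein) formula gives
`G(x, y) = A / (V x - β)` with `A` and `β` independent of `V x`. If the law `ν` of `V x` satisfies
`∫ |t - β|^(-s) dν ≤ Q` for all `β`, then the decoupling inequality
`∫ |t - β|^(-s) dν ≤ 3 Q J`, `J = ∫ |t - α|^s |t - β|^(-s) dν`, holds: the triangle inequality gives
`|α - β|^s ∫ |t - β|^(-s) dν ≤ J + 1`, and by the Cauchy-Schwarz inequality `J` is at least
`(∫ |t - β|^s |t - α|^(-s) dν)⁻¹ ≥ (1 + Q |α - β|^s)⁻¹`, which keeps `J` away from `0`.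
With `α = z`, averaging over `V x` first yields
`𝔼 |G(x, y)|^s ≤ κ (δ_{xy} + ∑_k 𝔼 |G(x + k, y)|^s)` with `κ = 3 Q`. For the potential `lam * ω` the
bound `Q` scales like `lam ^ (-s)`, so at large disorder each step towards `y` gains a factor `1/2`.
-/

namespace Anderson

section Operator

variable {d : ℕ}

/-- Translation `u ↦ u(· + k)` on `ℓ²(ℤ^d)`; the Laplacian is a sum of these. -/
def translate (k : Fin d → ℤ) : Ell2 d →ₗ[ℂ] Ell2 d where
  toFun u := ⟨fun n => u (n + k), memℓp_shift u k⟩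
  map_add' _ _ := rfl
  map_smul' _ _ := rfl

theorem inner_translate_left (k : Fin d → ℤ) (u w : Ell2 d) :
    inner ℂ (translate k u) w = inner ℂ u (translate (-k) w) := by
  rw [lp.inner_eq_tsum, lp.inner_eq_tsum,
    ← (Equiv.addRight k).tsum_eq fun n => inner ℂ (u n) (translate (-k) w n)]
  refine tsum_congr fun n => ?_
  change inner ℂ (u (n + k)) (w n) = inner ℂ (u (n + k)) (w (n + k + -k))
  rw [add_neg_cancel_right]

theorem latticeNorm_neg (k : Fin d → ℤ) : latticeNorm (-k) = latticeNorm k := by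
  simp only [latticeNorm, Pi.neg_apply, abs_neg]

theorem neg_mem_unitVectors {k : Fin d → ℤ} (hk : k ∈ unitVectors d) : -k ∈ unitVectors d := by
  rwa [mem_unitVectors, latticeNorm_neg, ← mem_unitVectors]

theorem laplacian_eq_neg_sum_translate (u : Ell2 d) :
    laplacian d u = -∑ k ∈ unitVectors d, translate k u := by
  ext n
  rw [lp.coeFn_neg, lp.coeFn_sum, Pi.neg_apply, Finset.sum_apply]
  rfl

theorem isSymmetric_laplacian : (laplacian d).IsSymmetric := by
  intro u w
  simp only [laplacian_eq_neg_sum_translate, inner_neg_left, inner_neg_right, sum_inner, inner_sum,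
    neg_inj]
  exact Finset.sum_nbij' (fun k => -k) (fun k => -k) (fun _ => neg_mem_unitVectors)
    (fun _ => neg_mem_unitVectors) (fun k _ => neg_neg k) (fun k _ => neg_neg k)
    fun k _ => inner_translate_left k u w

theorem im_inner_eq_zero_of_apply_eq_mul {ι : Type*} {v : ι → ℝ} {u g : lp (fun _ : ι => ℂ) 2}
    (h : ∀ n, g n = v n * u n) : (inner ℂ u g).im = 0 := by
  rw [← Complex.conj_eq_iff_im, inner_conj_symm, lp.inner_eq_tsum, lp.inner_eq_tsum]
  refine tsum_congr fun n => ?_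
  simp only [h, RCLike.inner_apply, map_mul, Complex.conj_ofReal]
  ring

/-- The graph of `h₀ + V - z`, i.e. the pairs `(u, f)` with `(h₀ + V - z) u = f` pointwise.
For `u, f ∈ ℓ²` this equation already forces `u` into the domain of `V`. -/
def solutionGraph (V : (Fin d → ℤ) → ℝ) (z : ℂ) : Submodule ℂ (Ell2 d × Ell2 d) where
  carrier := {p | ∀ n, laplacian d p.1 n + V n * p.1 n - z * p.1 n = p.2 n}
  zero_mem' n := by simp
  add_mem' {p q} hp hq n := by
    simp only [Prod.fst_add, Prod.snd_add, map_add, lp.coeFn_add, Pi.add_apply]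
    linear_combination hp n + hq n
  smul_mem' c p hp n := by
    simp only [Prod.smul_fst, Prod.smul_snd, map_smul, lp.coeFn_smul, Pi.smul_apply, smul_eq_mul]
    linear_combination c * hp n

variable {V : (Fin d → ℤ) → ℝ} {z : ℂ} {u f : Ell2 d}

theorem mem_solutionGraph :
    (u, f) ∈ solutionGraph V z ↔ ∀ n, laplacian d u n + V n * u n - z * u n = f n :=
  Iff.rfl

theorem mem_solutionGraph_iff_exists_domain :
    (u, f) ∈ solutionGraph V z ↔
      ∃ w : (schrodinger V).domain, schrodinger V w - z • (w : Ell2 d) = f ∧ (w : Ell2 d) = u := by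
  constructor
  · intro h
    have hdom : Memℓp (fun n => (V n : ℂ) * u n) 2 := by
      have hVu : (fun n => (V n : ℂ) * u n) = f - laplacian d u + z • u := by
        funext n
        simp only [Pi.add_apply, Pi.sub_apply, Pi.smul_apply, smul_eq_mul]
        linear_combination h n
      rw [hVu]
      exact lp.memℓp (f - laplacian d u + z • u)
    exact ⟨⟨u, hdom⟩, lp.ext (funext h), rfl⟩
  · rintro ⟨w, rfl, rfl⟩ n
    rfl

theorem im_inner_of_mem_solutionGraph (h : (u, f) ∈ solutionGraph V z) :
    (inner ℂ u f).im = -(z.im * ‖u‖ ^ 2) := by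
  have hV : (inner ℂ u (f - laplacian d u + z • u)).im = 0 :=
    im_inner_eq_zero_of_apply_eq_mul (v := V) fun n => by
      simp only [lp.coeFn_add, lp.coeFn_sub, lp.coeFn_smul, Pi.add_apply, Pi.sub_apply,
        Pi.smul_apply, smul_eq_mul]
      linear_combination -mem_solutionGraph.1 h n
  have hL : (inner ℂ u (laplacian d u)).im = 0 := isSymmetric_laplacian.im_inner_self_apply u
  have hz : (inner ℂ u (z • u)).im = z.im * ‖u‖ ^ 2 := by
    rw [inner_smul_right, inner_self_eq_norm_sq_to_K, ← RCLike.ofReal_pow]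
    exact Complex.im_mul_ofReal z _
  rw [inner_add_right, inner_sub_right, Complex.add_im, Complex.sub_im, hL, hz] at hV
  linarith

theorem abs_im_mul_norm_le (h : (u, f) ∈ solutionGraph V z) : |z.im| * ‖u‖ ≤ ‖f‖ := by
  rcases (norm_nonneg u).eq_or_lt with h0 | h0
  · simp [← h0]
  · refine le_of_mul_le_mul_left ?_ h0
    calc ‖u‖ * (|z.im| * ‖u‖) = |(inner ℂ u f).im| := by
          rw [im_inner_of_mem_solutionGraph h, abs_neg, abs_mul, abs_of_nonneg (sq_nonneg ‖u‖)]
          ring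
      _ ≤ ‖u‖ * ‖f‖ := (Complex.abs_im_le_norm _).trans (norm_inner_le_norm u f)

theorem norm_le_of_mem_solutionGraph (hz : z.im ≠ 0) (h : (u, f) ∈ solutionGraph V z) :
    ‖u‖ ≤ |z.im|⁻¹ * ‖f‖ := by
  rw [← div_eq_inv_mul, le_div_iff₀' (abs_pos.2 hz)]
  exact abs_im_mul_norm_le h

theorem eq_of_mem_solutionGraph (hz : z.im ≠ 0) {u' : Ell2 d} (h : (u, f) ∈ solutionGraph V z)
    (h' : (u', f) ∈ solutionGraph V z) : u = u' := by
  have hsub : (u - u', (0 : Ell2 d)) ∈ solutionGraph V z := by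
    simpa using sub_mem h h'
  simpa [sub_eq_zero] using norm_le_of_mem_solutionGraph hz hsub

theorem isClosed_solutionGraph (V : (Fin d → ℤ) → ℝ) (z : ℂ) :
    IsClosed (solutionGraph V z : Set (Ell2 d × Ell2 d)) := by
  have heval (n : Fin d → ℤ) : Continuous fun u : Ell2 d => u n :=
    (lp.evalCLM ℂ (fun _ : Fin d → ℤ => ℂ) 2 n).continuous
  have hL : Continuous (laplacian d) := isSymmetric_laplacian.continuous
  simp only [solutionGraph, Submodule.coe_set_mk, Set.ofPred_forall]
  refine isClosed_iInter fun n => isClosed_eq ?_ ((heval n).comp continuous_snd)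
  have h1 : Continuous fun p : Ell2 d × Ell2 d => p.1 n := (heval n).comp continuous_fst
  have h2 : Continuous fun p : Ell2 d × Ell2 d => laplacian d p.1 n :=
    (heval n).comp (hL.comp continuous_fst)
  fun_prop

theorem isClosed_image_snd_solutionGraph (hz : z.im ≠ 0) :
    IsClosed (Prod.snd '' (solutionGraph V z : Set (Ell2 d × Ell2 d))) := by
  have : CompleteSpace (solutionGraph V z) := (isClosed_solutionGraph V z).completeSpace_coe
  have hanti : AntilipschitzWith (max |z.im|⁻¹.toNNReal 1)
      (LinearMap.snd ℂ (Ell2 d) (Ell2 d) ∘ₗ (solutionGraph V z).subtype) := by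
    refine AddMonoidHomClass.antilipschitz_of_bound _ fun p => ?_
    have hp : ‖p.1.1‖ ≤ |z.im|⁻¹ * ‖p.1.2‖ := norm_le_of_mem_solutionGraph hz p.2
    rw [NNReal.coe_max, Real.coe_toNNReal _ (by positivity), NNReal.coe_one,
      max_mul_of_nonneg _ _ (norm_nonneg _), one_mul]
    exact max_le_max hp le_rfl
  have hrange := hanti.isClosed_range
    (uniformContinuous_snd.comp uniformContinuous_subtype_val)
  rwa [Set.image_eq_range]

theorem basisVec_mem_solutionGraph (V : (Fin d → ℤ) → ℝ) (z : ℂ) (n : Fin d → ℤ) :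
    (basisVec n, laplacian d (basisVec n) + (V n - z) • basisVec n) ∈ solutionGraph V z := by
  refine mem_solutionGraph.2 fun m => ?_
  rcases eq_or_ne m n with rfl | hm
  · simp only [lp.coeFn_add, lp.coeFn_smul, Pi.add_apply, Pi.smul_apply, smul_eq_mul]
    ring
  · simp only [lp.coeFn_add, lp.coeFn_smul, Pi.add_apply, Pi.smul_apply, smul_eq_mul,
      basisVec, lp.single_apply_ne _ _ _ hm]
    ring

theorem dense_span_image_basisVec (V : (Fin d → ℤ) → ℝ) (hz : z.im ≠ 0) :
    Dense (Submodule.span ℂ (Set.range fun n =>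
      laplacian d (basisVec n) + (V n - z) • basisVec n) : Set (Ell2 d)) := by
  rw [Submodule.dense_iff_topologicalClosure_eq_top, Submodule.topologicalClosure_eq_top_iff,
    Submodule.eq_bot_iff]
  intro w hw
  -- A vector orthogonal to the range of `h₀ + V - z` is a null vector of `h₀ + V - conj z`.
  have hsol : (w, 0) ∈ solutionGraph V ((starRingEnd ℂ) z) := by
    refine mem_solutionGraph.2 fun n => ?_
    have horth := (Submodule.mem_orthogonal _ _).1 hw _ (Submodule.subset_span ⟨n, rfl⟩)
    rw [inner_add_left, isSymmetric_laplacian, inner_smul_left, basisVec, lp.inner_single_left,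
      lp.inner_single_left] at horth
    simp only [RCLike.inner_apply, map_one, mul_one, map_sub, Complex.conj_ofReal] at horth
    rw [lp.coeFn_zero, Pi.zero_apply]
    linear_combination horth
  have hnorm : ‖w‖ ≤ |((starRingEnd ℂ) z).im|⁻¹ * ‖(0 : Ell2 d)‖ :=
    norm_le_of_mem_solutionGraph (by rwa [Complex.conj_im, neg_ne_zero]) hsol
  rwa [norm_zero, mul_zero, norm_le_zero_iff] at hnorm

theorem exists_mem_solutionGraph (V : (Fin d → ℤ) → ℝ) (hz : z.im ≠ 0) (f : Ell2 d) :
    ∃ u, (u, f) ∈ solutionGraph V z := by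
  have hspan : Submodule.span ℂ (Set.range fun n =>
      laplacian d (basisVec n) + (V n - z) • basisVec n) ≤
      (solutionGraph V z).map (LinearMap.snd ℂ _ _) := by
    rw [Submodule.span_le]
    rintro _ ⟨n, rfl⟩
    exact ⟨_, basisVec_mem_solutionGraph V z n, rfl⟩
  obtain ⟨⟨u, _⟩, hu, rfl⟩ :=
    (isClosed_image_snd_solutionGraph (V := V) hz).closure_subset_iff.2 hspan
      (dense_span_image_basisVec V hz f)
  exact ⟨u, hu⟩

theorem resolventApply_mem_solutionGraph (V : (Fin d → ℤ) → ℝ) (hz : z.im ≠ 0) (f : Ell2 d) :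
    (resolventApply (schrodinger V) z f, f) ∈ solutionGraph V z := by
  obtain ⟨u, hu⟩ := exists_mem_solutionGraph V hz f
  obtain ⟨w, hw, -⟩ := mem_solutionGraph_iff_exists_domain.1 hu
  have hex : ∃ w : (schrodinger V).domain, schrodinger V w - z • (w : Ell2 d) = f := ⟨w, hw⟩
  rw [resolventApply, dif_pos hex]
  exact mem_solutionGraph_iff_exists_domain.2 ⟨hex.choose, hex.choose_spec, rfl⟩

theorem resolventApply_add (V : (Fin d → ℤ) → ℝ) (hz : z.im ≠ 0) (f g : Ell2 d) :
    resolventApply (schrodinger V) z (f + g) =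
      resolventApply (schrodinger V) z f + resolventApply (schrodinger V) z g := by
  have h := add_mem (resolventApply_mem_solutionGraph V hz f)
    (resolventApply_mem_solutionGraph V hz g)
  rw [Prod.mk_add_mk] at h
  exact eq_of_mem_solutionGraph hz (resolventApply_mem_solutionGraph V hz (f + g)) h

theorem resolventApply_smul (V : (Fin d → ℤ) → ℝ) (hz : z.im ≠ 0) (c : ℂ) (f : Ell2 d) :
    resolventApply (schrodinger V) z (c • f) = c • resolventApply (schrodinger V) z f := by
  have h := Submodule.smul_mem _ c (resolventApply_mem_solutionGraph V hz f)
  rw [Prod.smul_mk] at h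
  exact eq_of_mem_solutionGraph hz (resolventApply_mem_solutionGraph V hz (c • f)) h

/-- The resolvent `(h₀ + V - z)⁻¹` at a non-real `z`, as a bounded operator. -/
noncomputable def resolvent (V : (Fin d → ℤ) → ℝ) (hz : z.im ≠ 0) : Ell2 d →L[ℂ] Ell2 d :=
  LinearMap.mkContinuous
    { toFun := resolventApply (schrodinger V) z
      map_add' := resolventApply_add V hz
      map_smul' := resolventApply_smul V hz }
    |z.im|⁻¹ fun f => norm_le_of_mem_solutionGraph hz (resolventApply_mem_solutionGraph V hz f)

theorem resolvent_mem_solutionGraph (V : (Fin d → ℤ) → ℝ) (hz : z.im ≠ 0) (f : Ell2 d) :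
    (resolvent V hz f, f) ∈ solutionGraph V z :=
  resolventApply_mem_solutionGraph V hz f

theorem resolvent_eq_of_mem_solutionGraph (hz : z.im ≠ 0) (h : (u, f) ∈ solutionGraph V z) :
    resolvent V hz f = u :=
  eq_of_mem_solutionGraph hz (resolvent_mem_solutionGraph V hz f) h

theorem norm_resolvent_le (V : (Fin d → ℤ) → ℝ) (hz : z.im ≠ 0) :
    ‖resolvent V hz‖ ≤ |z.im|⁻¹ :=
  LinearMap.mkContinuous_norm_le _ (by positivity) _

theorem resolvent_laplacian_basisVec (V : (Fin d → ℤ) → ℝ) (hz : z.im ≠ 0) (n : Fin d → ℤ)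
    (c : ℂ) :
    resolvent V hz (laplacian d (basisVec n) + c • basisVec n) =
      basisVec n + (c - (V n - z)) • resolvent V hz (basisVec n) := by
  have h : resolvent V hz (laplacian d (basisVec n) + (V n - z) • basisVec n) = basisVec n :=
    resolvent_eq_of_mem_solutionGraph hz (basisVec_mem_solutionGraph V z n)
  rw [map_add, map_smul] at h ⊢
  rw [eq_sub_of_add_eq h]
  module

theorem continuous_resolvent_apply (hz : z.im ≠ 0) (f : Ell2 d) :
    Continuous fun V : (Fin d → ℤ) → ℝ => resolvent V hz f := by
  refine continuous_iff_continuousAt.2 fun V₀ => ?_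
  -- The vectors along which the resolvents converge form a closed subspace, and on the images
  -- `(h₀ + V₀ - z) e_n` convergence only involves the single value `V n`.
  let S : Submodule ℂ (Ell2 d) :=
    { carrier := {f | Filter.Tendsto (fun V => resolvent V hz f) (nhds V₀)
        (nhds (resolvent V₀ hz f))}
      zero_mem' := by simp
      add_mem' := fun hf hg => by simpa using hf.add hg
      smul_mem' := fun c f hf => by simpa using hf.const_smul c }
  have hclosed : IsClosed (S : Set (Ell2 d)) := by
    have hbdd : ∃ C, ∀ V : (Fin d → ℤ) → ℝ, ‖resolvent V hz‖ ≤ C :=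
      ⟨|z.im|⁻¹, fun V => norm_resolvent_le V hz⟩
    have hequi : Equicontinuous fun V : (Fin d → ℤ) → ℝ => ⇑(resolvent V hz) :=
      ((NormedSpace.equicontinuous_TFAE fun V => resolvent V hz).out 1 5).2 hbdd
    exact hequi.isClosed_setOfPred_tendsto (resolvent V₀ hz).continuous
  have hspan : Submodule.span ℂ (Set.range fun n =>
      laplacian d (basisVec n) + (V₀ n - z) • basisVec n) ≤ S := by
    rw [Submodule.span_le]
    rintro _ ⟨n, rfl⟩
    have hV : Filter.Tendsto (fun V : (Fin d → ℤ) → ℝ => (V₀ n - V n : ℂ)) (nhds V₀) (nhds 0) := by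
      have h : Continuous fun V : (Fin d → ℤ) → ℝ => (V₀ n - V n : ℂ) := by fun_prop
      simpa using h.tendsto V₀
    have hbdd : Filter.IsBoundedUnder (· ≤ ·) (nhds V₀)
        fun V : (Fin d → ℤ) → ℝ => ‖resolvent V hz (basisVec n)‖ :=
      Filter.isBoundedUnder_of ⟨|z.im|⁻¹ * ‖(basisVec n : Ell2 d)‖, fun V =>
        norm_le_of_mem_solutionGraph hz (resolvent_mem_solutionGraph V hz _)⟩
    simpa [S, resolvent_laplacian_basisVec] using
      (hV.zero_smul_isBoundedUnder_le hbdd).const_add (basisVec n)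
  exact hclosed.closure_subset_iff.2 hspan (dense_span_image_basisVec V₀ hz f)

/-- The Green function `⟨e_x, (h₀ + V - z)⁻¹ e_y⟩` of the Schrödinger operator `h₀ + V`. -/
noncomputable def greenOf (V : (Fin d → ℤ) → ℝ) (z : ℂ) (x y : Fin d → ℤ) : ℂ :=
  resolventApply (schrodinger V) z (basisVec y) x

theorem green_eq_greenOf (lam : ℝ) (ω : (Fin d → ℤ) → ℝ) (z : ℂ) (x y : Fin d → ℤ) :
    green lam ω x y z = greenOf (fun n => lam * ω n) z x y := by
  rw [green, basisVec, lp.inner_single_left, RCLike.inner_apply, map_one, mul_one]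
  rfl

theorem continuous_greenOf (hz : z.im ≠ 0) (x y : Fin d → ℤ) :
    Continuous fun V : (Fin d → ℤ) → ℝ => greenOf V z x y :=
  (lp.evalCLM ℂ (fun _ : Fin d → ℤ => ℂ) 2 x).continuous.comp
    (continuous_resolvent_apply hz (basisVec y))

theorem norm_greenOf_le (V : (Fin d → ℤ) → ℝ) (hz : z.im ≠ 0) (x y : Fin d → ℤ) :
    ‖greenOf V z x y‖ ≤ |z.im|⁻¹ :=
  calc ‖greenOf V z x y‖ ≤ ‖resolvent V hz (basisVec y)‖ := lp.norm_apply_le_norm two_ne_zero _ x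
    _ ≤ |z.im|⁻¹ * ‖(basisVec y : Ell2 d)‖ :=
      norm_le_of_mem_solutionGraph hz (resolvent_mem_solutionGraph V hz _)
    _ = |z.im|⁻¹ := by rw [basisVec, lp.norm_single two_pos, norm_one, mul_one]

theorem sub_mul_greenOf (V : (Fin d → ℤ) → ℝ) (hz : z.im ≠ 0) (x y : Fin d → ℤ) :
    (V x - z) * greenOf V z x y =
      (if x = y then 1 else 0) + ∑ k ∈ unitVectors d, greenOf V z (x + k) y := by
  have h : -∑ k ∈ unitVectors d, greenOf V z (x + k) y + V x * greenOf V z x y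
      - z * greenOf V z x y = basisVec y x := resolventApply_mem_solutionGraph V hz (basisVec y) x
  rw [basisVec, lp.single_apply, Pi.single_apply] at h
  linear_combination h

theorem resolvent_update (V : (Fin d → ℤ) → ℝ) (hz : z.im ≠ 0) (x : Fin d → ℤ) (t : ℝ)
    (f : Ell2 d) :
    resolvent V hz f = resolvent (Function.update V x t) hz f +
      ((t - V x) * resolvent (Function.update V x t) hz f x) • resolvent V hz (basisVec x) := by
  refine resolvent_eq_of_mem_solutionGraph hz fun n => ?_
  have hg := mem_solutionGraph.1 (resolvent_mem_solutionGraph (Function.update V x t) hz f) n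
  have hw := mem_solutionGraph.1 (resolvent_mem_solutionGraph V hz (basisVec x)) n
  set g := resolvent (Function.update V x t) hz f
  set w := resolvent V hz (basisVec x)
  simp only [map_add, map_smul, lp.coeFn_add, lp.coeFn_smul, Pi.add_apply, Pi.smul_apply,
    smul_eq_mul]
  rw [basisVec, lp.single_apply] at hw
  rcases eq_or_ne n x with rfl | hn
  · rw [Function.update_self] at hg
    rw [Pi.single_eq_same] at hw
    linear_combination hg + (t - V n) * g n * hw
  · rw [Function.update_of_ne hn] at hg
    rw [Pi.single_eq_of_ne hn] at hw
    linear_combination hg + (t - V x) * g x * hw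

theorem greenOf_update_mul (V : (Fin d → ℤ) → ℝ) (hz : z.im ≠ 0) (x y : Fin d → ℤ) (t : ℝ) :
    greenOf (Function.update V x t) z x y * (1 + (t - V x) * greenOf V z x x) =
      greenOf V z x y := by
  have h : greenOf V z x y = greenOf (Function.update V x t) z x y +
      (t - V x) * greenOf (Function.update V x t) z x y * greenOf V z x x :=
    congrArg (fun w : Ell2 d => w x) (resolvent_update V hz x t (basisVec y))
  rw [h]
  ring

theorem im_greenOf_self_ne_zero (V : (Fin d → ℤ) → ℝ) (hz : z.im ≠ 0) (x : Fin d → ℤ) :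
    (greenOf V z x x).im ≠ 0 := by
  have hw := resolvent_mem_solutionGraph V hz (basisVec x)
  have hne : resolvent V hz (basisVec x) ≠ 0 := by
    intro h0
    have h1 := mem_solutionGraph.1 hw x
    rw [h0] at h1
    simp [basisVec] at h1
  have him := im_inner_of_mem_solutionGraph hw
  have hinner : inner ℂ (resolvent V hz (basisVec x)) (basisVec x) =
      (starRingEnd ℂ) (greenOf V z x x) := by
    rw [basisVec, lp.inner_single_right, RCLike.inner_apply, one_mul]
    rfl
  rw [hinner, Complex.conj_im, neg_inj] at him
  rw [him]
  exact mul_ne_zero hz (pow_ne_zero 2 (norm_ne_zero_iff.2 hne))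

theorem exists_greenOf_update_eq_div (V : (Fin d → ℤ) → ℝ) (hz : z.im ≠ 0) (x y : Fin d → ℤ) :
    ∃ A β : ℂ, ∀ t : ℝ, (t : ℂ) ≠ β ∧ greenOf (Function.update V x t) z x y = A / (t - β) := by
  have him := im_greenOf_self_ne_zero V hz x
  have hg : greenOf V z x x ≠ 0 := fun h => him (by rw [h, Complex.zero_im])
  refine ⟨greenOf V z x y / greenOf V z x x, V x - (greenOf V z x x)⁻¹, fun t => ?_⟩
  have hβ : (t : ℂ) ≠ V x - (greenOf V z x x)⁻¹ := by
    intro h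
    have h_im := congrArg Complex.im h
    simp [hg, him] at h_im
  refine ⟨hβ, (eq_div_iff (sub_ne_zero.2 hβ)).2 ?_⟩
  rw [← greenOf_update_mul V hz x y t]
  field_simp
  ring

end Operator

theorem one_le_lintegral_mul_lintegral_inv {X : Type*} [MeasurableSpace X] {ν : Measure X}
    [IsProbabilityMeasure ν] {f : X → ℝ≥0∞} (hf : AEMeasurable f ν)
    (h0 : ∀ᵐ t ∂ν, f t ≠ 0) (htop : ∀ᵐ t ∂ν, f t ≠ ∞) :
    1 ≤ (∫⁻ t, f t ∂ν) * ∫⁻ t, (f t)⁻¹ ∂ν := by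
  have hCS : 1 ≤ ((∫⁻ t, f t ∂ν) * ∫⁻ t, (f t)⁻¹ ∂ν) ^ (2⁻¹ : ℝ) :=
    calc 1 = ∫⁻ t, f t ^ (2⁻¹ : ℝ) * (f t)⁻¹ ^ (2⁻¹ : ℝ) ∂ν := by
          rw [← measure_univ (μ := ν), ← lintegral_one]
          refine lintegral_congr_ae ?_
          filter_upwards [h0, htop] with t ht0 httop
          rw [← ENNReal.mul_rpow_of_nonneg _ _ (by positivity), ENNReal.mul_inv_cancel ht0 httop,
            ENNReal.one_rpow]
      _ ≤ (∫⁻ t, f t ∂ν) ^ (2⁻¹ : ℝ) * (∫⁻ t, (f t)⁻¹ ∂ν) ^ (2⁻¹ : ℝ) :=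
          ENNReal.lintegral_mul_norm_pow_le hf hf.inv (by positivity) (by positivity)
            (by norm_num)
      _ = _ := (ENNReal.mul_rpow_of_nonneg _ _ (by positivity)).symm
  rwa [← ENNReal.one_rpow 2⁻¹, ENNReal.rpow_le_rpow_iff (by positivity)] at hCS

/-- The Riesz potential `∫ dist t β ^ (-s) dν(t)` of order `s` of the measure `ν` at the point `β`.
For `s > 0` an atom of `ν` at `β` makes it infinite. -/
noncomputable def rieszPotential {X : Type*} [MeasurableSpace X] [PseudoEMetricSpace X]
    (ν : Measure X) (s : ℝ) (β : X) : ℝ≥0∞ :=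
  ∫⁻ t, edist t β ^ (-s) ∂ν

section Decoupling

variable {X : Type*} [MeasurableSpace X]

section PseudoEMetric

variable [PseudoEMetricSpace X] [OpensMeasurableSpace X] {ν : Measure X} {s : ℝ}

theorem measurable_edist_rpow (α : X) (r : ℝ) : Measurable fun t => edist t α ^ r :=
  (continuous_id.edist continuous_const).measurable.pow_const r

theorem ae_edist_ne_zero {α : X} (hs : 0 < s) (hα : rieszPotential ν s α ≠ ∞) :
    ∀ᵐ t ∂ν, edist t α ≠ 0 := by
  filter_upwards [ae_lt_top (measurable_edist_rpow α (-s)) hα] with t ht h0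
  rw [h0, ENNReal.zero_rpow_of_neg (neg_neg_of_pos hs)] at ht
  exact ht.false

variable [IsProbabilityMeasure ν]

theorem edist_rpow_mul_rieszPotential_le (hs0 : 0 ≤ s) (hs1 : s ≤ 1) (α β : X) :
    edist α β ^ s * rieszPotential ν s β ≤
      ∫⁻ t, edist t α ^ s * edist t β ^ (-s) ∂ν + 1 := by
  have hmeas : Measurable fun t => edist t α ^ s * edist t β ^ (-s) :=
    (measurable_edist_rpow α s).mul (measurable_edist_rpow β (-s))
  calc edist α β ^ s * rieszPotential ν s β
      = ∫⁻ t, edist α β ^ s * edist t β ^ (-s) ∂ν :=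
        (lintegral_const_mul _ (measurable_edist_rpow β (-s))).symm
    _ ≤ ∫⁻ t, (edist t α ^ s * edist t β ^ (-s) + 1) ∂ν := lintegral_mono fun t => ?_
    _ = _ := by rw [lintegral_add_left hmeas, lintegral_one, measure_univ]
  calc edist α β ^ s * edist t β ^ (-s)
      ≤ (edist t α ^ s + edist t β ^ s) * edist t β ^ (-s) := by
        gcongr
        refine (ENNReal.rpow_le_rpow (edist_triangle_left α β t) hs0).trans ?_
        exact ENNReal.rpow_add_le_add_rpow _ _ hs0 hs1
    _ ≤ edist t α ^ s * edist t β ^ (-s) + 1 := by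
        rw [add_mul, ENNReal.rpow_neg]
        gcongr
        exact ENNReal.mul_inv_le_one _

theorem lintegral_edist_rpow_mul_le (hs0 : 0 ≤ s) (hs1 : s ≤ 1) (α β : X) :
    ∫⁻ t, edist t β ^ s * edist t α ^ (-s) ∂ν ≤ 1 + edist α β ^ s * rieszPotential ν s α := by
  calc ∫⁻ t, edist t β ^ s * edist t α ^ (-s) ∂ν
      ≤ ∫⁻ t, (1 + edist α β ^ s * edist t α ^ (-s)) ∂ν := lintegral_mono fun t => ?_
    _ = _ := by
      rw [lintegral_add_left measurable_const, lintegral_one, measure_univ,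
        lintegral_const_mul _ (measurable_edist_rpow α (-s)), rieszPotential]
  calc edist t β ^ s * edist t α ^ (-s)
      ≤ (edist t α ^ s + edist α β ^ s) * edist t α ^ (-s) := by
        gcongr
        refine (ENNReal.rpow_le_rpow (edist_triangle t α β) hs0).trans ?_
        exact ENNReal.rpow_add_le_add_rpow _ _ hs0 hs1
    _ ≤ 1 + edist α β ^ s * edist t α ^ (-s) := by
        rw [add_mul, ENNReal.rpow_neg]
        gcongr
        exact ENNReal.mul_inv_le_one _

end PseudoEMetric

variable [PseudoMetricSpace X] [OpensMeasurableSpace X] {ν : Measure X} [IsProbabilityMeasure ν]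
  {s : ℝ}

theorem one_le_lintegral_mul_lintegral_swap (hs0 : 0 < s) {α β : X}
    (hα : rieszPotential ν s α ≠ ∞) (hβ : rieszPotential ν s β ≠ ∞) :
    1 ≤ (∫⁻ t, edist t α ^ s * edist t β ^ (-s) ∂ν) *
      ∫⁻ t, edist t β ^ s * edist t α ^ (-s) ∂ν := by
  have hmeas : Measurable fun t => edist t α ^ s * edist t β ^ (-s) :=
    (measurable_edist_rpow α s).mul (measurable_edist_rpow β (-s))
  have hα0 : ∀ᵐ t ∂ν, edist t α ^ s ≠ 0 := by
    filter_upwards [ae_edist_ne_zero hs0 hα] with t ht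
    exact (ENNReal.rpow_pos (pos_iff_ne_zero.2 ht) (edist_ne_top t α)).ne'
  have hβ0 : ∀ᵐ t ∂ν, edist t β ^ s ≠ 0 := by
    filter_upwards [ae_edist_ne_zero hs0 hβ] with t ht
    exact (ENNReal.rpow_pos (pos_iff_ne_zero.2 ht) (edist_ne_top t β)).ne'
  have htop (t γ : X) : edist t γ ^ s ≠ ∞ := ENNReal.rpow_ne_top_of_nonneg hs0.le (edist_ne_top t γ)
  have hinv : ∫⁻ t, (edist t α ^ s * edist t β ^ (-s))⁻¹ ∂ν =
      ∫⁻ t, edist t β ^ s * edist t α ^ (-s) ∂ν := by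
    refine lintegral_congr_ae ?_
    filter_upwards [hα0] with t ha
    rw [ENNReal.mul_inv (Or.inl ha) (Or.inl (htop t α)), ENNReal.rpow_neg, ENNReal.rpow_neg,
      inv_inv, mul_comm]
  rw [← hinv]
  refine one_le_lintegral_mul_lintegral_inv hmeas.aemeasurable ?_ ?_
  · filter_upwards [hα0] with t ha
    rw [ENNReal.rpow_neg]
    exact mul_ne_zero ha (ENNReal.inv_ne_zero.2 (htop t β))
  · filter_upwards [hβ0] with t hb
    rw [ENNReal.rpow_neg]
    exact ENNReal.mul_ne_top (htop t α) (ENNReal.inv_ne_top.2 hb)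

theorem rieszPotential_le_mul_lintegral (hs0 : 0 < s) (hs1 : s ≤ 1) {Q : ℝ≥0∞} (hQ : Q ≠ ∞)
    (hν : ∀ β, rieszPotential ν s β ≤ Q) (α β : X) :
    rieszPotential ν s β ≤ 3 * Q * ∫⁻ t, edist t α ^ s * edist t β ^ (-s) ∂ν := by
  have hne (γ : X) : rieszPotential ν s γ ≠ ∞ := ne_top_of_le_ne_top hQ (hν γ)
  set D := edist α β ^ s
  set I := rieszPotential ν s β
  set J := ∫⁻ t, edist t α ^ s * edist t β ^ (-s) ∂ν
  have hDtop : D ≠ ∞ := ENNReal.rpow_ne_top_of_nonneg hs0.le (edist_ne_top α β)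
  have hI : I ≤ Q := hν β
  have hDI : D * I ≤ J + 1 := edist_rpow_mul_rieszPotential_le hs0.le hs1 α β
  have hJ : 1 ≤ J * (1 + D * Q) :=
    (one_le_lintegral_mul_lintegral_swap hs0 (hne α) (hne β)).trans <| by
      gcongr
      refine (lintegral_edist_rpow_mul_le hs0.le hs1 α β).trans ?_
      gcongr
      exact hν α
  have hfac : (1 + D * Q) * I ≤ (1 + D * Q) * (3 * Q * J) :=
    calc (1 + D * Q) * I = I + Q * (D * I) := by ring
      _ ≤ Q + Q * (J + 1) := by gcongr
      _ = 2 * Q * 1 + Q * J * 1 := by ring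
      _ ≤ 2 * Q * (J * (1 + D * Q)) + Q * J * (1 + D * Q) := by
        gcongr
        exact le_self_add
      _ = (1 + D * Q) * (3 * Q * J) := by ring
  refine (ENNReal.mul_le_mul_iff_right ?_ ?_).1 hfac
  · simp
  · exact ENNReal.add_ne_top.2 ⟨ENNReal.one_ne_top, ENNReal.mul_ne_top hDtop hQ⟩

end Decoupling

theorem rieszPotential_map_ofReal_le (ν : Measure ℝ) {s : ℝ} (hs : 0 ≤ s) (β : ℂ) :
    rieszPotential (ν.map Complex.ofReal) s β ≤ rieszPotential ν s β.re := by
  rw [rieszPotential, lintegral_map (measurable_edist_rpow β (-s)) Complex.measurable_ofReal]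
  refine lintegral_mono fun t => ?_
  have hre : edist t β.re ≤ edist (t : ℂ) β := by
    rw [edist_dist, edist_dist, Real.dist_eq, Complex.dist_eq]
    refine ENNReal.ofReal_le_ofReal ?_
    simpa using Complex.abs_re_le_norm (t - β)
  rw [ENNReal.rpow_neg, ENNReal.rpow_neg]
  exact ENNReal.inv_le_inv.2 (ENNReal.rpow_le_rpow hre hs)

theorem rieszPotential_map_mul_left (ν : Measure ℝ) (s : ℝ) {lam : ℝ} (hlam : 0 < lam) (β : ℝ) :
    rieszPotential (ν.map (lam * ·)) s β =
      ENNReal.ofReal lam ^ (-s) * rieszPotential ν s (β / lam) := by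
  rw [rieszPotential, lintegral_map (measurable_edist_rpow β (-s)) (measurable_const_mul lam),
    rieszPotential, ← lintegral_const_mul _ (measurable_edist_rpow _ (-s))]
  refine lintegral_congr fun t => ?_
  have h : edist (lam * t) β = ENNReal.ofReal lam * edist t (β / lam) := by
    rw [edist_dist, edist_dist, ← ENNReal.ofReal_mul hlam.le, Real.dist_eq, Real.dist_eq,
      ← abs_of_pos hlam, ← abs_mul, abs_of_pos hlam, mul_sub, mul_div_cancel₀ _ hlam.ne']
  rw [h, ENNReal.mul_rpow_of_ne_top ENNReal.ofReal_ne_top (edist_ne_top _ _)]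

theorem setLIntegral_ball_enorm_rpow_neg_lt_top {E : Type*} [NormedAddCommGroup E]
    [NormedSpace ℝ E] [FiniteDimensional ℝ E] [MeasurableSpace E] [BorelSpace E] (μ : Measure E)
    [μ.IsAddHaarMeasure] {s : ℝ} (hs0 : 0 < s) (hs : s < Module.finrank ℝ E) (r : ℝ) :
    ∫⁻ t in Metric.ball 0 r, ‖t‖ₑ ^ (-s) ∂μ < ∞ := by
  have hd : 1 ≤ Module.finrank ℝ E := Nat.one_le_iff_ne_zero.2 fun h => by
    rw [h, Nat.cast_zero] at hs
    exact hs.not_gt hs0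
  have : Nontrivial E := Module.nontrivial_of_finrank_pos hd
  have hint : IntegrableOn (fun t : E => ‖t‖ ^ (-s)) (Metric.ball 0 r) μ :=
    integrableOn_ball_of_norm_le_rpow (C := 1) hd hs
      (.of_forall fun t => by
        rw [one_mul, Real.norm_of_nonneg (Real.rpow_nonneg (norm_nonneg t) _)])
      (measurable_norm.pow_const (-s)).aestronglyMeasurable
  refine lt_of_eq_of_lt (lintegral_congr_ae (ae_restrict_of_ae ?_)) hint.hasFiniteIntegral
  filter_upwards [compl_mem_ae_iff.2 (measure_singleton (0 : E))] with t ht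
  rw [Real.enorm_of_nonneg (Real.rpow_nonneg (norm_nonneg t) _),
    ← ENNReal.ofReal_rpow_of_pos (norm_pos_iff.2 ht), ofReal_norm]

theorem setLIntegral_ball_edist_rpow_neg {E : Type*} [SeminormedAddCommGroup E]
    [MeasurableSpace E] [BorelSpace E] (μ : Measure E) [μ.IsAddRightInvariant] (s r : ℝ) (β : E) :
    ∫⁻ t in Metric.ball β r, edist t β ^ (-s) ∂μ = ∫⁻ t in Metric.ball 0 r, ‖t‖ₑ ^ (-s) ∂μ := by
  have hball : (· - β) ⁻¹' Metric.ball 0 r = Metric.ball β r := by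
    ext t
    simp [dist_eq_norm]
  have h := (measurePreserving_sub_right μ β).setLIntegral_comp_preimage
    (Metric.isOpen_ball (x := (0 : E)) (ε := r)).measurableSet (measurable_enorm.pow_const (-s))
  simpa only [hball, ← edist_eq_enorm_sub] using h

theorem exists_rieszPotential_le {E : Type*} [NormedAddCommGroup E] [NormedSpace ℝ E]
    [FiniteDimensional ℝ E] [MeasurableSpace E] [BorelSpace E] {μ ν : Measure E}
    [μ.IsAddHaarMeasure] [IsProbabilityMeasure ν] {K : ℝ≥0∞} (hK : K ≠ ∞) (hν : ν ≤ K • μ)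
    {s : ℝ} (hs0 : 0 < s) (hs : s < Module.finrank ℝ E) :
    ∃ Q ≠ ∞, ∀ β, rieszPotential ν s β ≤ Q := by
  refine ⟨K * ∫⁻ t in Metric.ball 0 1, ‖t‖ₑ ^ (-s) ∂μ + 1, ?_, fun β => ?_⟩
  · exact ENNReal.add_ne_top.2 ⟨ENNReal.mul_ne_top hK
      (setLIntegral_ball_enorm_rpow_neg_lt_top μ hs0 hs 1).ne, ENNReal.one_ne_top⟩
  rw [rieszPotential, ← lintegral_add_compl _ (Metric.isOpen_ball (x := β) (ε := 1)).measurableSet]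
  gcongr
  · calc ∫⁻ t in Metric.ball β 1, edist t β ^ (-s) ∂ν
        ≤ ∫⁻ t in Metric.ball β 1, edist t β ^ (-s) ∂(K • μ) := by gcongr
      _ = K * ∫⁻ t in Metric.ball 0 1, ‖t‖ₑ ^ (-s) ∂μ := by
        rw [Measure.restrict_smul, lintegral_smul_measure, smul_eq_mul,
          setLIntegral_ball_edist_rpow_neg]
  · calc ∫⁻ t in (Metric.ball β 1)ᶜ, edist t β ^ (-s) ∂ν
        ≤ ∫⁻ _ in (Metric.ball β 1)ᶜ, 1 ∂ν := by
          refine setLIntegral_mono measurable_const fun t ht => ?_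
          have hle : 1 ≤ edist t β := by
            rw [edist_dist, ENNReal.one_le_ofReal]
            simpa using ht
          rw [ENNReal.rpow_neg, ENNReal.inv_le_one]
          exact ENNReal.one_le_rpow hle hs0
      _ ≤ 1 := by
        rw [setLIntegral_one]
        exact prob_le_one

theorem withDensity_ofReal_le_eLpNorm_top_smul {X : Type*} [MeasurableSpace X] (μ : Measure X)
    (ρ : X → ℝ) : μ.withDensity (fun v => ENNReal.ofReal (ρ v)) ≤ eLpNorm ρ ∞ μ • μ := by
  rw [← withDensity_const, eLpNorm_exponent_top]
  refine withDensity_mono ?_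
  filter_upwards [ae_le_eLpNormEssSup (f := ρ) (μ := μ)] with t ht
  exact (Real.ofReal_le_enorm (ρ t)).trans ht

theorem measurePreserving_update_infinitePi {ι : Type*} [DecidableEq ι] {X : ι → Type*}
    [∀ i, MeasurableSpace (X i)] (ν : ∀ i, Measure (X i)) [∀ i, IsProbabilityMeasure (ν i)]
    (x : ι) :
    MeasurePreserving (fun p : (∀ i, X i) × X x => Function.update p.1 x p.2)
      ((Measure.infinitePi ν).prod (ν x)) (Measure.infinitePi ν) := by
  refine ⟨measurable_update', Measure.eq_infinitePi _ fun I t ht => ?_⟩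
  have hpre : (fun p : (∀ i, X i) × X x => Function.update p.1 x p.2) ⁻¹' Set.pi I t =
      Set.pi (I.erase x) t ×ˢ {r | x ∈ I → r ∈ t x} := by
    ext p
    rw [Finset.coe_erase]
    exact Set.update_mem_pi_iff
  rw [Measure.map_apply measurable_update' (.pi I.countable_toSet fun i _ => ht i), hpre,
    Measure.prod_prod, Measure.infinitePi_pi _ fun i _ => ht i]
  by_cases hx : x ∈ I
  · simp only [hx, true_imp_iff, Set.ofPred_mem_eq]
    exact Finset.prod_erase_mul I _ hx
  · simp only [hx, false_imp_iff, Set.ofPred_true, measure_univ, mul_one,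
      Finset.erase_eq_of_notMem hx]

theorem lintegral_infinitePi_eq_lintegral_update {ι : Type*} [DecidableEq ι] {X : ι → Type*}
    [∀ i, MeasurableSpace (X i)] (ν : ∀ i, Measure (X i)) [∀ i, IsProbabilityMeasure (ν i)]
    (x : ι) {F : (∀ i, X i) → ℝ≥0∞} (hF : Measurable F) :
    ∫⁻ v, F v ∂Measure.infinitePi ν =
      ∫⁻ v, ∫⁻ t, F (Function.update v x t) ∂ν x ∂Measure.infinitePi ν := by
  have h := measurePreserving_update_infinitePi ν x
  rw [← h.lintegral_comp hF]
  exact lintegral_prod _ (hF.comp h.measurable).aemeasurable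

theorem enorm_add_sum_rpow_le {ι E : Type*} [NormedAddCommGroup E] (K : Finset ι) (a : E)
    (f : ι → E) {s : ℝ} (hs0 : 0 < s) (hs1 : s ≤ 1) :
    ‖a + ∑ k ∈ K, f k‖ₑ ^ s ≤ ‖a‖ₑ ^ s + ∑ k ∈ K, ‖f k‖ₑ ^ s := by
  have hadd (b c : ℝ≥0∞) : (b + c) ^ s ≤ b ^ s + c ^ s :=
    ENNReal.rpow_add_le_add_rpow b c hs0.le hs1
  calc ‖a + ∑ k ∈ K, f k‖ₑ ^ s
      ≤ (‖a‖ₑ + ∑ k ∈ K, ‖f k‖ₑ) ^ s := by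
        refine ENNReal.rpow_le_rpow ?_ hs0.le
        exact enorm_add_le_of_le le_rfl (enorm_sum_le K f)
    _ ≤ ‖a‖ₑ ^ s + (∑ k ∈ K, ‖f k‖ₑ) ^ s := hadd _ _
    _ ≤ ‖a‖ₑ ^ s + ∑ k ∈ K, ‖f k‖ₑ ^ s := by
        gcongr
        exact Finset.le_sum_of_subadditive (· ^ s) (ENNReal.zero_rpow_of_pos hs0).le hadd K _

/-- The fractional moment `𝔼 |G(x, y; z)| ^ s` of the Green function, for a potential with
independent values of law `σ`. -/
noncomputable def fractionalMoment {d : ℕ} (σ : Measure ℝ) (s : ℝ) (z : ℂ)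
    (x y : Fin d → ℤ) : ℝ≥0∞ :=
  ∫⁻ V, ‖greenOf V z x y‖ₑ ^ s ∂Measure.infinitePi fun _ : Fin d → ℤ => σ

section FractionalMoment

variable {d : ℕ} {σ : Measure ℝ} [IsProbabilityMeasure σ] {s : ℝ} {z : ℂ}

theorem measurable_enorm_greenOf_rpow (s : ℝ) (hz : z.im ≠ 0) (x y : Fin d → ℤ) :
    Measurable fun V : (Fin d → ℤ) → ℝ => ‖greenOf V z x y‖ₑ ^ s :=
  (continuous_greenOf hz x y).measurable.enorm.pow_const s

theorem fractionalMoment_le (hs : 0 ≤ s) (hz : z.im ≠ 0) (x y : Fin d → ℤ) :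
    fractionalMoment σ s z x y ≤ ENNReal.ofReal |z.im|⁻¹ ^ s := by
  calc fractionalMoment σ s z x y
      ≤ ∫⁻ _, ENNReal.ofReal |z.im|⁻¹ ^ s ∂Measure.infinitePi fun _ : Fin d → ℤ => σ := by
        refine lintegral_mono fun V => ?_
        rw [← ofReal_norm]
        gcongr
        exact norm_greenOf_le V hz x y
    _ = ENNReal.ofReal |z.im|⁻¹ ^ s := by rw [lintegral_const, measure_univ, mul_one]

theorem lintegral_enorm_greenOf_update_rpow_le (hs0 : 0 < s) (hs1 : s ≤ 1) {Q : ℝ≥0∞}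
    (hQ : Q ≠ ∞) (hσ : ∀ β, rieszPotential (σ.map Complex.ofReal) s β ≤ Q)
    (V : (Fin d → ℤ) → ℝ) (hz : z.im ≠ 0) (x y : Fin d → ℤ) :
    ∫⁻ t, ‖greenOf (Function.update V x t) z x y‖ₑ ^ s ∂σ ≤
      3 * Q * ∫⁻ t, ‖(t - z) * greenOf (Function.update V x t) z x y‖ₑ ^ s ∂σ := by
  obtain ⟨A, β, hG⟩ := exists_greenOf_update_eq_div V hz x y
  have hnorm (t : ℝ) : ‖A / (t - β)‖ₑ ^ s = ‖A‖ₑ ^ s * edist (t : ℂ) β ^ (-s) := by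
    rw [div_eq_mul_inv, enorm_mul, ENNReal.mul_rpow_of_nonneg _ _ hs0.le,
      enorm_inv (sub_ne_zero.2 (hG t).1), ENNReal.inv_rpow, ← ENNReal.rpow_neg, edist_eq_enorm_sub]
  have hprob : IsProbabilityMeasure (σ.map Complex.ofReal) :=
    Measure.isProbabilityMeasure_map Complex.measurable_ofReal.aemeasurable
  have hdec := rieszPotential_le_mul_lintegral hs0 hs1 hQ hσ z β
  rw [rieszPotential, lintegral_map (measurable_edist_rpow β (-s)) Complex.measurable_ofReal,
    lintegral_map (f := fun t => edist t z ^ s * edist t β ^ (-s))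
      ((measurable_edist_rpow z s).mul (measurable_edist_rpow β (-s)))
      Complex.measurable_ofReal] at hdec
  have hAtop : ‖A‖ₑ ^ s ≠ ∞ := ENNReal.rpow_ne_top_of_nonneg hs0.le enorm_ne_top
  calc ∫⁻ t, ‖greenOf (Function.update V x t) z x y‖ₑ ^ s ∂σ
      = ‖A‖ₑ ^ s * ∫⁻ t : ℝ, edist (t : ℂ) β ^ (-s) ∂σ := by
        simp only [(hG _).2, hnorm]
        exact lintegral_const_mul' _ _ hAtop
    _ ≤ ‖A‖ₑ ^ s * (3 * Q * ∫⁻ t : ℝ, edist (t : ℂ) z ^ s * edist (t : ℂ) β ^ (-s) ∂σ) := by gcongr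
    _ = 3 * Q * ∫⁻ t : ℝ, ‖A‖ₑ ^ s * (edist (t : ℂ) z ^ s * edist (t : ℂ) β ^ (-s)) ∂σ := by
        rw [lintegral_const_mul' _ _ hAtop, mul_left_comm]
    _ = _ := by
        congr 1
        refine lintegral_congr fun t => ?_
        rw [(hG t).2, enorm_mul, ENNReal.mul_rpow_of_nonneg _ _ hs0.le, hnorm, edist_eq_enorm_sub]
        ring

theorem fractionalMoment_le_mul_add_sum (hs0 : 0 < s) (hs1 : s ≤ 1) {Q : ℝ≥0∞} (hQ : Q ≠ ∞)
    (hσ : ∀ β, rieszPotential (σ.map Complex.ofReal) s β ≤ Q) (hz : z.im ≠ 0)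
    (x y : Fin d → ℤ) :
    fractionalMoment σ s z x y ≤
      3 * Q * ((if x = y then 1 else 0) +
        ∑ k ∈ unitVectors d, fractionalMoment σ s z (x + k) y) := by
  set μ : Measure ((Fin d → ℤ) → ℝ) := Measure.infinitePi fun _ => σ with hμ
  have hmeas : Measurable fun V : (Fin d → ℤ) → ℝ => ‖((V x : ℂ) - z) * greenOf V z x y‖ₑ ^ s :=
    (((Complex.measurable_ofReal.comp (measurable_pi_apply x)).sub_const z).mul
      (continuous_greenOf hz x y).measurable).enorm.pow_const s
  calc fractionalMoment σ s z x y
      = ∫⁻ V, ∫⁻ t, ‖greenOf (Function.update V x t) z x y‖ₑ ^ s ∂σ ∂μ :=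
        lintegral_infinitePi_eq_lintegral_update (fun _ => σ) x
          (measurable_enorm_greenOf_rpow s hz x y)
    _ ≤ ∫⁻ V, 3 * Q * ∫⁻ t, ‖(t - z) * greenOf (Function.update V x t) z x y‖ₑ ^ s ∂σ ∂μ :=
        lintegral_mono fun V => lintegral_enorm_greenOf_update_rpow_le hs0 hs1 hQ hσ V hz x y
    _ = 3 * Q * ∫⁻ V, ‖((V x : ℂ) - z) * greenOf V z x y‖ₑ ^ s ∂μ := by
        rw [lintegral_const_mul' _ _ (ENNReal.mul_ne_top ENNReal.ofNat_ne_top hQ), hμ,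
          lintegral_infinitePi_eq_lintegral_update (fun _ => σ) x hmeas]
        simp only [Function.update_self]
    _ ≤ 3 * Q * ∫⁻ V, ((if x = y then 1 else 0) +
          ∑ k ∈ unitVectors d, ‖greenOf V z (x + k) y‖ₑ ^ s) ∂μ := by
        gcongr with V
        rw [sub_mul_greenOf V hz x y]
        refine (enorm_add_sum_rpow_le _ _ _ hs0 hs1).trans_eq ?_
        congr 1
        split_ifs <;> simp [hs0]
    _ = _ := by
        rw [lintegral_add_left measurable_const, lintegral_const, measure_univ, mul_one,
          lintegral_finsetSum _ fun k _ => measurable_enorm_greenOf_rpow s hz (x + k) y]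
        rfl

end FractionalMoment

theorem iSup_le_two_mul_of_le_mul_add_sum {ι : Type*} [Add ι] {f : ι → ℝ≥0∞} {κ B : ℝ≥0∞}
    {K : Finset ι} (hB : B ≠ ∞) (hfB : ∀ x, f x ≤ B) (hκ : κ * K.card ≤ 2⁻¹)
    (hf : ∀ x, f x ≤ κ * (1 + ∑ k ∈ K, f (x + k))) : ⨆ x, f x ≤ 2 * κ := by
  set S := ⨆ x, f x
  have hS : 2⁻¹ * S ≠ ∞ :=
    ENNReal.mul_ne_top (by simp) (ne_top_of_le_ne_top hB (iSup_le hfB))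
  have hhalf : 2⁻¹ * S + 2⁻¹ * S ≤ κ + 2⁻¹ * S :=
    calc 2⁻¹ * S + 2⁻¹ * S = S := by rw [← add_mul, ENNReal.inv_two_add_inv_two, one_mul]
      _ ≤ κ * (1 + K.card * S) := iSup_le fun x => by
        grw [hf x, Finset.sum_le_card_nsmul K _ S fun k _ => le_iSup f (x + k), nsmul_eq_mul]
      _ = κ + κ * K.card * S := by ring
      _ ≤ κ + 2⁻¹ * S := by gcongr
  calc S = 2 * (2⁻¹ * S) := (ENNReal.mul_inv_cancel_left two_ne_zero ENNReal.ofNat_ne_top).symm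
    _ ≤ 2 * κ := by
      gcongr
      exact (ENNReal.add_le_add_iff_right hS).1 hhalf

theorem le_two_mul_mul_inv_two_pow_of_le_mul_add_sum {ι : Type*} [Add ι] [DecidableEq ι]
    {f : ι → ℝ≥0∞} {κ B : ℝ≥0∞} {K : Finset ι} {r : ι → ℕ} {y : ι} (hB : B ≠ ∞)
    (hfB : ∀ x, f x ≤ B) (hκ : κ * K.card ≤ 2⁻¹)
    (hf : ∀ x, f x ≤ κ * ((if x = y then 1 else 0) + ∑ k ∈ K, f (x + k)))
    (hry : r y = 0) (hr : ∀ x, ∀ k ∈ K, r x ≤ r (x + k) + 1) (x : ι) :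
    f x ≤ 2 * κ * 2⁻¹ ^ r x := by
  suffices h : ∀ n x, n ≤ r x → f x ≤ 2 * κ * 2⁻¹ ^ n from h _ x le_rfl
  intro n
  induction n with
  | zero =>
    intro x _
    rw [pow_zero, mul_one]
    refine (le_iSup f x).trans
      (iSup_le_two_mul_of_le_mul_add_sum hB hfB hκ fun x => (hf x).trans ?_)
    gcongr
    split_ifs <;> simp
  | succ n ih =>
    intro x hn
    have hxy : x ≠ y := by
      rintro rfl
      omega
    calc f x ≤ κ * ∑ k ∈ K, f (x + k) := by simpa only [if_neg hxy, zero_add] using hf x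
      _ ≤ κ * (K.card * (2 * κ * 2⁻¹ ^ n)) := by
        grw [Finset.sum_le_card_nsmul K _ (2 * κ * 2⁻¹ ^ n) fun k hk =>
          ih (x + k) (by have := hr x k hk; omega), nsmul_eq_mul]
      _ = κ * K.card * (2 * κ * 2⁻¹ ^ n) := by ring
      _ ≤ 2⁻¹ * (2 * κ * 2⁻¹ ^ n) := by gcongr
      _ = 2 * κ * 2⁻¹ ^ (n + 1) := by ring

theorem latticeNorm_nonneg {d : ℕ} (n : Fin d → ℤ) : 0 ≤ latticeNorm n :=
  Finset.sum_nonneg fun _ _ => abs_nonneg _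

theorem latticeNorm_sub_le {d : ℕ} (m n : Fin d → ℤ) :
    latticeNorm (m - n) ≤ latticeNorm m + latticeNorm n := by
  simp only [latticeNorm, ← Finset.sum_add_distrib]
  exact Finset.sum_le_sum fun i _ => abs_sub (m i) (n i)

theorem fractionalMoment_le_two_mul_mul_inv_two_pow {d : ℕ} {σ : Measure ℝ}
    [IsProbabilityMeasure σ] {s : ℝ} (hs0 : 0 < s) (hs1 : s ≤ 1) {Q : ℝ≥0∞} (hQ : Q ≠ ∞)
    (hσ : ∀ β, rieszPotential (σ.map Complex.ofReal) s β ≤ Q)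
    (hQd : 3 * Q * (unitVectors d).card ≤ 2⁻¹) {z : ℂ} (hz : z.im ≠ 0) (x y : Fin d → ℤ) :
    fractionalMoment σ s z x y ≤ 2 * (3 * Q) * 2⁻¹ ^ (latticeNorm (x - y)).toNat := by
  refine le_two_mul_mul_inv_two_pow_of_le_mul_add_sum (f := (fractionalMoment σ s z · y))
    (r := fun x => (latticeNorm (x - y)).toNat)
    (ENNReal.rpow_ne_top_of_nonneg hs0.le ENNReal.ofReal_ne_top)
    (fractionalMoment_le hs0.le hz · y) hQd
    (fractionalMoment_le_mul_add_sum hs0 hs1 hQ hσ hz · y) ?_ (fun x k hk => ?_) x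
  · simp [latticeNorm]
  · have h := latticeNorm_sub_le (x + k - y) k
    rw [add_sub_right_comm, add_sub_cancel_right, (mem_unitVectors k).1 hk,
      ← add_sub_right_comm] at h
    omega

theorem lintegral_enorm_green_rpow {d : ℕ} {ν : Measure ℝ} {Ω : Type*} [MeasurableSpace Ω]
    {P : Measure Ω} [IsProbabilityMeasure P] {ω : (Fin d → ℤ) → Ω → ℝ}
    (hω : ∀ n, Measurable (ω n)) (hlaw : ∀ n, P.map (ω n) = ν) (hind : iIndepFun ω P)
    (lam s : ℝ) {z : ℂ} (hz : z.im ≠ 0) (x y : Fin d → ℤ) :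
    ∫⁻ a, ‖green lam (fun n => ω n a) x y z‖ₑ ^ s ∂P =
      fractionalMoment (ν.map (lam * ·)) s z x y := by
  have hV (n : Fin d → ℤ) : Measurable fun a => lam * ω n a := (hω n).const_mul lam
  have hmap : P.map (fun a n => lam * ω n a) = Measure.infinitePi fun _ => ν.map (lam * ·) := by
    rw [(iIndepFun_iff_map_fun_eq_infinitePi_map hV).1
      (hind.comp (fun _ => (lam * ·)) fun _ => measurable_const_mul lam)]
    congr 1
    funext n
    rw [← hlaw n, Measure.map_map (measurable_const_mul lam) (hω n)]
    rfl
  rw [fractionalMoment, ← hmap, lintegral_map (measurable_enorm_greenOf_rpow s hz x y)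
    (measurable_pi_lambda _ hV)]
  simp only [green_eq_greenOf]

theorem measurable_green {d : ℕ} {Ω : Type*} [MeasurableSpace Ω] {ω : (Fin d → ℤ) → Ω → ℝ}
    (hω : ∀ n, Measurable (ω n)) (lam : ℝ) {z : ℂ} (hz : z.im ≠ 0) (x y : Fin d → ℤ) :
    Measurable fun a => green lam (fun n => ω n a) x y z := by
  simp only [green_eq_greenOf]
  exact (continuous_greenOf hz x y).measurable.comp
    (measurable_pi_lambda _ fun n => (hω n).const_mul lam)

theorem integrable_norm_rpow_and_integral_le {Ω E : Type*} [MeasurableSpace Ω]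
    [SeminormedAddCommGroup E] {P : Measure Ω} {f : Ω → E} (hf : AEStronglyMeasurable f P) {s : ℝ}
    (hs : 0 ≤ s) {B : ℝ≥0∞} (hB : B ≠ ∞) (h : ∫⁻ a, ‖f a‖ₑ ^ s ∂P ≤ B) :
    Integrable (fun a => ‖f a‖ ^ s) P ∧ ∫ a, ‖f a‖ ^ s ∂P ≤ B.toReal := by
  have hmeas : AEMeasurable (fun a => ‖f a‖ₑ ^ s) P := hf.enorm.pow_const s
  have hpow : (fun a => ‖f a‖ ^ s) = fun a => (‖f a‖ₑ ^ s).toReal := by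
    funext a
    rw [← ENNReal.toReal_rpow, toReal_enorm]
  rw [hpow]
  refine ⟨integrable_toReal_of_lintegral_ne_top hmeas (ne_top_of_le_ne_top hB h), ?_⟩
  rw [integral_toReal hmeas
    (.of_forall fun a => ENNReal.rpow_lt_top_of_nonneg hs enorm_ne_top)]
  exact ENNReal.toReal_mono hB h

theorem exists_forall_ge_ofReal_rpow_neg_mul_le {s : ℝ} (hs : 0 < s) {c ε : ℝ≥0∞} (hc : c ≠ ∞)
    (hε : ε ≠ 0) :
    ∃ lam₀ : ℝ, 0 < lam₀ ∧ ∀ lam, lam₀ ≤ lam → ENNReal.ofReal lam ^ (-s) * c ≤ ε := by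
  have hlim : Filter.Tendsto (fun lam => ENNReal.ofReal lam ^ (-s) * c) Filter.atTop (nhds 0) := by
    have h := ((ENNReal.continuous_rpow_const (y := -s)).tendsto ∞).comp
      ENNReal.tendsto_ofReal_atTop
    rw [ENNReal.top_rpow_of_neg (neg_neg_of_pos hs)] at h
    simpa only [zero_mul, Function.comp_apply] using ENNReal.Tendsto.mul_const h (.inr hc)
  obtain ⟨lam₀, hlam₀⟩ := Filter.eventually_atTop.1
    (hlim.eventually_le_const (pos_iff_ne_zero.2 hε))
  exact ⟨max lam₀ 1, by positivity, fun lam h => hlam₀ lam ((le_max_left _ _).trans h)⟩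

theorem inv_two_pow_toNat {n : ℤ} (hn : 0 ≤ n) :
    (2⁻¹ : ℝ) ^ n.toNat = Real.exp (-Real.log 2 * n) := by
  lift n to ℕ using hn
  rw [Int.toNat_natCast, Int.cast_natCast, mul_comm, Real.exp_nat_mul, Real.exp_neg,
    Real.exp_log two_pos]

end Anderson

theorem theorem4p1_general (d : ℕ) (ν : Measure ℝ) [IsProbabilityMeasure ν] (s : ℝ) (hs0 : 0 < s)
    (hs1 : s < 1) (hν : ∃ Q ≠ ∞, ∀ β, Anderson.rieszPotential ν s β ≤ Q) :
    ∃ lam₀ : ℝ, 0 < lam₀ ∧ ∀ lam : ℝ, lam₀ ≤ lam →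
      ∃ C m : ℝ, 0 < m ∧
        ∀ (Ω : Type*) [MeasurableSpace Ω] (P : Measure Ω) [IsProbabilityMeasure P]
          (ω : (Fin d → ℤ) → Ω → ℝ),
          (∀ n, Measurable (ω n)) → (∀ n, P.map (ω n) = ν) → iIndepFun ω P →
          ∀ (x y : Fin d → ℤ) (z : ℂ), z.im ≠ 0 →
            Integrable (fun a => ‖Anderson.green lam (fun n => ω n a) x y z‖ ^ s) P ∧
            ∫ a, ‖Anderson.green lam (fun n => ω n a) x y z‖ ^ s ∂P
              ≤ C * Real.exp (-m * (Anderson.latticeNorm (x - y) : ℝ)) := by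
  obtain ⟨Q, hQ, hν⟩ := hν
  obtain ⟨lam₀, hlam₀, hsmall⟩ := Anderson.exists_forall_ge_ofReal_rpow_neg_mul_le hs0
    (c := 3 * Q * (Anderson.unitVectors d).card) (ε := 2⁻¹) (by finiteness) (by simp)
  refine ⟨lam₀, hlam₀, fun lam hlam => ?_⟩
  set q := ENNReal.ofReal lam ^ (-s) * Q
  have hpos : 0 < lam := hlam₀.trans_le hlam
  have hq : q ≠ ∞ :=
    ENNReal.mul_ne_top
      (ENNReal.rpow_ne_top_of_nonneg' (ENNReal.ofReal_pos.2 hpos) ENNReal.ofReal_ne_top) hQ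
  have hσ (β : ℂ) : Anderson.rieszPotential ((ν.map (lam * ·)).map Complex.ofReal) s β ≤ q := by
    refine (Anderson.rieszPotential_map_ofReal_le _ hs0.le β).trans ?_
    rw [Anderson.rieszPotential_map_mul_left ν s hpos]
    exact mul_le_mul_right (hν _) _
  have hqd : 3 * q * (Anderson.unitVectors d).card ≤ 2⁻¹ := by
    convert hsmall lam hlam using 1
    ring
  have := Measure.isProbabilityMeasure_map (μ := ν) (measurable_const_mul lam).aemeasurable
  refine ⟨(2 * (3 * q)).toReal, Real.log 2, Real.log_pos one_lt_two, ?_⟩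
  intro Ω _ P _ ω hω hlaw hind x y z hz
  have hint := Anderson.integrable_norm_rpow_and_integral_le
    (Anderson.measurable_green hω lam hz x y).aestronglyMeasurable hs0.le (by finiteness)
    ((Anderson.lintegral_enorm_green_rpow hω hlaw hind lam s hz x y).trans_le
      (Anderson.fractionalMoment_le_two_mul_mul_inv_two_pow hs0 hs1.le hq hσ hqd hz x y))
  rwa [ENNReal.toReal_mul, ENNReal.toReal_pow, ENNReal.toReal_inv, ENNReal.toReal_ofNat,
    Anderson.inv_two_pow_toNat (Anderson.latticeNorm_nonneg _)] at hint

theorem theorem4p1 (d : ℕ) (hd : 1 ≤ d)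
    (ν : Measure ℝ) [IsProbabilityMeasure ν]
    (ρ : ℝ → ℝ) (hρ_nonneg : 0 ≤ᵐ[volume] ρ) (hρ_bdd : MemLp ρ ∞ volume)
    (hρ_supp : HasCompactSupport ρ)
    (hν : ν = volume.withDensity fun v => ENNReal.ofReal (ρ v))
    (s : ℝ) (hs0 : 0 < s) (hs1 : s < 1) :
    ∃ lam₀ : ℝ, 0 < lam₀ ∧ ∀ lam : ℝ, lam₀ ≤ lam →
      ∃ C m : ℝ, 0 < m ∧
        ∀ (Ω : Type*) [MeasurableSpace Ω] (P : Measure Ω) [IsProbabilityMeasure P]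
          (ω : (Fin d → ℤ) → Ω → ℝ),
          (∀ n, Measurable (ω n)) → (∀ n, P.map (ω n) = ν) → iIndepFun ω P →
          ∀ (x y : Fin d → ℤ) (z : ℂ), z.im ≠ 0 →
            Integrable (fun a => ‖Anderson.green lam (fun n => ω n a) x y z‖ ^ s) P ∧
            ∫ a, ‖Anderson.green lam (fun n => ω n a) x y z‖ ^ s ∂P
              ≤ C * Real.exp (-m * (Anderson.latticeNorm (x - y) : ℝ)) := by
  refine theorem4p1_general d ν s hs0 hs1 ?_
  refine Anderson.exists_rieszPotential_le hρ_bdd.eLpNorm_ne_top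
    (hν.trans_le (Anderson.withDensity_ofReal_le_eLpNorm_top_smul volume ρ)) hs0 ?_
  rwa [Module.finrank_self, Nat.cast_one]
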